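/- Let $\mathcal A$ be a unital $C^*$-algebra and $\mathcal H$ a Hilbert $C^*$-module over $\mathcal A$, with $\mathcal A$-valued inner product $\langle\cdot,\cdot\rangle$ that is $\mathcal A$-linear in the first variable. For a Hilbert $\mathcal A$-module $\mathcal M$ let $L(\mathcal M)$ be the $C^*$-algebra of all adjointable operators on $\mathcal M$, and $GL^+(\mathcal M)\subset L(\mathcal M)$ the set of its positive invertible elements. For $C\in GL^+(\mathcal M)$, $K\in L(\mathcal M)$ and a finite or countable index set $\mathbb J$, a family $\{\psi_j\}_{j\in\mathbb J}$ in $\mathcal M$ is called a $C$-controlled $K$-frame for $\mathcal M$ if there are constants $0<A\le B<\infty$ such that for all $f\in\mathcal M$ $$A\,\langle C^{1/2}K^*f,\,C^{1/2}K^*f\rangle\ \le\ \sum_{j\in\mathbb J}\langle f,\psi_j\rangle\langle C\psi_j,f\rangle\ \le\ B\,\langle f,f\rangle ,$$ where the series converges in norm (unconditionally). **Theorem.** Let $C\in GL^+(\mathcal H)$, $K\in L(\mathcal H)$, and let $\{\psi_j\}_{j\in\mathbb J}$ be a $C$-controlled $K$-frame for $\mathcal H$. Let $T\in L(\mathcal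 H)$ have closed range $R(T)$, suppose that $\overline{R(TK)}$ is orthogonally complemented in $\mathcal H$, and that $C,K,T$ commute pairwise. Then $\{T\psi_j\}_{j\in\mathbb J}$ is a $C$-controlled $K$-frame for the Hilbert $\mathcal A$-module $R(T)$. That is: $C$ and $K$ map $R(T)$ into itself, the restrictions satisfy $C|_{R(T)}\in GL^+(R(T))$ and $K|_{R(T)}\in L(R(T))$, and $\{T\psi_j\}_{j\in\mathbb J}$ is a $C|_{R(T)}$-controlled $K|_{R(T)}$-frame for $R(T)$ (so the adjoint of $K|_{R(T)}$ is taken in $L(R(T))$). -/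

import Mathlib

/-!
Hilbert modules over a unital C⋆-algebra `A` are Mathlib's `CStarModule A E` on a complete space
`E`. Mathlib's inner product is `A`-linear in the second variable, so the `A`-valued inner product
`⟨x, y⟩` which is `A`-linear in the first variable, `⟨a x, y⟩ = a ⟨x, y⟩`, is `inner A y x`.
-/

set_option linter.unusedSectionVars false

noncomputable section

namespace HilbertCStarModule

section Operators

variable (A E : Type*) [CStarAlgebra A] [PartialOrder A] [StarOrderedRing A]
  [NormedAddCommGroup E] [NormedSpace ℂ E] [Module A E] [CStarModule A E]

/-- `S` is an adjoint of `T` for the `A`-valued inner product. -/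
def IsAdjoint (T S : E →L[ℂ] E) : Prop := ∀ x y : E, inner A (T x) y = inner A x (S y)

variable {A E}

theorem ext_inner {x y : E} (h : ∀ z : E, inner A z x = inner A z y) : x = y := by
  rw [← sub_eq_zero, ← CStarModule.inner_self (A := A), CStarModule.inner_sub_right, h, sub_self]

theorem IsAdjoint.symm {T S : E →L[ℂ] E} (h : IsAdjoint A E T S) : IsAdjoint A E S T := by
  intro x y
  rw [← CStarModule.star_inner, ← h, CStarModule.star_inner]

theorem IsAdjoint.unique {T S S' : E →L[ℂ] E} (h : IsAdjoint A E T S)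
    (h' : IsAdjoint A E T S') : S = S' := by
  ext y
  exact ext_inner (A := A) fun x => by rw [← h, ← h']

theorem IsAdjoint.map_smul {T S : E →L[ℂ] E} (h : IsAdjoint A E T S) (a : A) (x : E) :
    T (a • x) = a • T x :=
  ext_inner (A := A) fun z => by
    rw [← h.symm, CStarModule.inner_op_smul_right, CStarModule.inner_op_smul_right, h.symm]

theorem IsAdjoint.norm_sq_le {T S : E →L[ℂ] E} (h : IsAdjoint A E T S) :
    ‖T‖ * ‖T‖ ≤ ‖S * T‖ := by
  rw [← sq]
  refine (Real.le_sqrt (norm_nonneg _) (norm_nonneg _)).1 ?_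
  refine T.opNorm_le_bound (Real.sqrt_nonneg _) fun x => ?_
  rw [← Real.sqrt_sq (norm_nonneg x), ← Real.sqrt_mul (norm_nonneg _)]
  refine Real.le_sqrt_of_sq_le ?_
  rw [CStarModule.norm_sq_eq A, h]
  refine (CStarModule.norm_inner_le E).trans ?_
  calc ‖x‖ * ‖S (T x)‖ ≤ ‖x‖ * (‖S * T‖ * ‖x‖) := by
        gcongr
        exact (S * T).le_opNorm x
    _ = ‖S * T‖ * ‖x‖ ^ 2 := by ring

variable (A E)

/-- The algebra `L(E)` of all adjointable operators on `E`. -/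
def adjointableOps : Subalgebra ℂ (E →L[ℂ] E) where
  carrier := {T | ∃ S : E →L[ℂ] E, IsAdjoint A E T S}
  mul_mem' := by
    rintro T T' ⟨S, hS⟩ ⟨S', hS'⟩
    exact ⟨S' * S, fun x y => by simp [hS _ _, hS' _ _]⟩
  add_mem' := by
    rintro T T' ⟨S, hS⟩ ⟨S', hS'⟩
    exact ⟨S + S', fun x y => by simp [hS _ _, hS' _ _]⟩
  algebraMap_mem' c := ⟨algebraMap ℂ _ (star c), fun x y => by
    simp [Algebra.algebraMap_eq_smul_one]⟩

/-- The type `L(E)` of all adjointable operators on `E`. -/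
abbrev Adjointable : Type _ := adjointableOps A E

variable {A E}

instance : CoeFun (Adjointable A E) (fun _ => E → E) := ⟨fun T => (T : E →L[ℂ] E)⟩

instance : Star (Adjointable A E) :=
  ⟨fun T => ⟨Classical.choose T.2, ⟨T.1, (Classical.choose_spec T.2).symm⟩⟩⟩

theorem isAdjoint_star (T : Adjointable A E) :
    IsAdjoint A E (T : E →L[ℂ] E) ((star T : Adjointable A E) : E →L[ℂ] E) :=
  Classical.choose_spec T.2

theorem star_eq_of_isAdjoint {T S : Adjointable A E}
    (h : IsAdjoint A E (T : E →L[ℂ] E) (S : E →L[ℂ] E)) : star T = S :=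
  Subtype.ext ((isAdjoint_star T).unique h)

instance : StarRing (Adjointable A E) where
  star_involutive T := star_eq_of_isAdjoint (isAdjoint_star T).symm
  star_mul T S := star_eq_of_isAdjoint fun x y => by
    simp [isAdjoint_star T _ _, isAdjoint_star S _ _]
  star_add T S := star_eq_of_isAdjoint fun x y => by
    simp [isAdjoint_star T _ _, isAdjoint_star S _ _]

instance : StarModule ℂ (Adjointable A E) where
  star_smul c T := star_eq_of_isAdjoint fun x y => by
    simp [isAdjoint_star T _ _]

instance : CStarRing (Adjointable A E) where
  norm_mul_self_le T := (isAdjoint_star T).norm_sq_le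

instance [CompleteSpace E] : CompleteSpace (Adjointable A E) := by
  refine Metric.complete_of_cauchySeq_tendsto fun u hu => ?_
  have hsub : ∀ v : ℕ → Adjointable A E, CauchySeq v →
      ∃ T : E →L[ℂ] E, Filter.Tendsto (fun n => (v n : E →L[ℂ] E)) Filter.atTop (nhds T) :=
    fun v hv => cauchySeq_tendsto_of_complete
      (uniformContinuous_subtype_val.comp_cauchySeq hv)
  have hus : CauchySeq fun n => star (u n) := by
    rw [Metric.cauchySeq_iff] at hu ⊢
    intro ε hε
    obtain ⟨N, hN⟩ := hu ε hε
    refine ⟨N, fun m hm n hn => ?_⟩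
    have h : star (u m) - star (u n) = star (u m - u n) := (star_sub (u m) (u n)).symm
    have h' : ‖star (u m - u n)‖ = ‖u m - u n‖ := norm_star (u m - u n)
    have h'' : dist (star (u m)) (star (u n)) = dist (u m) (u n) :=
      (dist_eq_norm _ _).trans ((congrArg norm h).trans (h'.trans (dist_eq_norm _ _).symm))
    rw [h'']
    exact hN m hm n hn
  obtain ⟨T, hT⟩ := hsub u hu
  obtain ⟨S, hS⟩ := hsub _ hus
  have hadj : IsAdjoint A E T S := fun x y => by
    have hc : Continuous (fun p : E × E => inner A p.1 p.2) := CStarModule.continuous_inner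
    have h1 : Filter.Tendsto (fun n => inner A ((u n : E →L[ℂ] E) x) y) Filter.atTop
        (nhds (inner A (T x) y)) :=
      (hc.tendsto (T x, y)).comp
        ((((ContinuousLinearMap.apply ℂ E x).continuous.tendsto T).comp hT).prodMk_nhds
          tendsto_const_nhds)
    have h2 : Filter.Tendsto
        (fun n => inner A x (((star (u n) : Adjointable A E) : E →L[ℂ] E) y)) Filter.atTop
        (nhds (inner A x (S y))) :=
      (hc.tendsto (x, S y)).comp (tendsto_const_nhds.prodMk_nhds
        (((ContinuousLinearMap.apply ℂ E y).continuous.tendsto S).comp hS))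
    refine tendsto_nhds_unique h1 (h2.congr fun n => ?_)
    exact (isAdjoint_star (u n) x y).symm
  exact ⟨⟨T, S, hadj⟩, tendsto_subtype_rng.2 hT⟩

/-- The adjointable operators on a Hilbert module form a unital C⋆-algebra. -/
instance [CompleteSpace E] : CStarAlgebra (Adjointable A E) where

/-- `T ≤ S` iff `S - T` is a positive element of the C⋆-algebra `L(E)`. -/
instance [CompleteSpace E] : PartialOrder (Adjointable A E) := CStarAlgebra.spectralOrder _

instance [CompleteSpace E] : StarOrderedRing (Adjointable A E) :=
  CStarAlgebra.spectralOrderedRing _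

/-- The range `R(T)` of an adjointable operator, as an `A`-submodule of `E`. -/
def range (T : Adjointable A E) : Submodule A E where
  carrier := Set.range T
  add_mem' := by
    rintro _ _ ⟨x, rfl⟩ ⟨y, rfl⟩
    exact ⟨x + y, map_add _ _ _⟩
  zero_mem' := ⟨0, map_zero _⟩
  smul_mem' := by
    rintro a _ ⟨x, rfl⟩
    exact ⟨a • x, (isAdjoint_star T).map_smul a x⟩

/-- A submodule with the inherited inner product. -/
instance (M : Submodule A E) [IsScalarTower ℂ A E] : CStarModule A M where
  inner x y := inner A (x : E) (y : E)
  inner_add_right := CStarModule.inner_add_right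
  inner_self_nonneg := CStarModule.inner_self_nonneg
  inner_self := CStarModule.inner_self.trans Submodule.coe_eq_zero
  inner_op_smul_right := CStarModule.inner_op_smul_right
  inner_smul_right_complex := CStarModule.inner_smul_right_complex
  star_inner _ _ := CStarModule.star_inner _ _
  norm_eq_sqrt_norm_inner_self x := CStarModule.norm_eq_sqrt_norm_inner_self (x : E)

variable (A) in
/-- `M` is orthogonally complemented in `E`: `E = M + M^⊥`. -/
def IsOrthogonallyComplemented (M : Set E) : Prop :=
  ∀ x : E, ∃ m ∈ M, ∃ n : E, (∀ y ∈ M, inner A y n = 0) ∧ x = m + n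

end Operators

section Frames

variable {A E J : Type*} [CStarAlgebra A] [PartialOrder A] [StarOrderedRing A]
  [NormedAddCommGroup E] [NormedSpace ℂ E] [Module A E] [CStarModule A E] [CompleteSpace E]

/-- `{ψ j}` is a `C`-controlled `K`-frame for the Hilbert module `E`: `C` is a positive invertible
operator, and there are constants `0 < a ≤ b` such that for all `f` the series
`∑ ⟨f, ψ j⟩ ⟨C (ψ j), f⟩` converges in norm and
`a ⟨C^{1/2} K⋆ f, C^{1/2} K⋆ f⟩ ≤ ∑ ⟨f, ψ j⟩ ⟨C (ψ j), f⟩ ≤ b ⟨f, f⟩`. -/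
structure IsControlledKFrame (C K : Adjointable A E) (ψ : J → E) : Prop where
  nonneg : 0 ≤ C
  isUnit : IsUnit C
  bounds : ∃ a b : ℝ, 0 < a ∧ a ≤ b ∧ ∀ f : E,
    Summable (fun j => inner A (ψ j) f * inner A f (C (ψ j))) ∧
    a • inner A ((CFC.sqrt C) ((star K) f)) ((CFC.sqrt C) ((star K) f)) ≤
      ∑' j, inner A (ψ j) f * inner A f (C (ψ j)) ∧
    ∑' j, inner A (ψ j) f * inner A f (C (ψ j)) ≤ b • inner A f f

end Frames

end HilbertCStarModule

end

noncomputable section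

namespace HilbertCStarModule

/-! ### Operator inequalities and invertibility in `L(E)` -/

section Operators

variable {A E : Type*} [CStarAlgebra A] [PartialOrder A] [StarOrderedRing A]
  [NormedAddCommGroup E] [NormedSpace ℂ E] [Module A E] [CStarModule A E]

/-! Since `C` commutes with `T`, the frame sum of `T ψ j` at `f` is the sum of `ψ j` at `T⋆ f`. The
upper bound follows from `⟨T⋆ f, T⋆ f⟩ ≤ ‖T⋆‖² ⟨f, f⟩`.

For the lower bound, let `P` be the projection onto `R(T)`. The adjoint of `K|R(T)` is `P K⋆|R(T)`,
and the square root of `C|R(T)` is `C^{1/2}|R(T)`, so the vector to control is `g = C^{1/2} P K⋆ f`,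
which lies in `R(T)`. As `T⋆ P = T⋆`, commutation gives `T⋆ g = C^{1/2} K⋆ T⋆ f`, and it remains to
use `⟨g, g⟩ ≤ c ⟨T⋆ g, T⋆ g⟩` on `R(T)`.

Both `P` and `c` come from `isUnit_rangeSquare`: closedness of `R(T)` makes `T T⋆` invertible on
`R(T)`. -/

theorem inner_apply_left (X : Adjointable A E) (x y : E) :
    inner A (X x) y = inner A x ((star X) y) :=
  isAdjoint_star X x y

theorem inner_apply_right (X : Adjointable A E) (x y : E) :
    inner A x (X y) = inner A ((star X) x) y :=
  ((isAdjoint_star X).symm x y).symm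

theorem apply_apply_of_commute {X Y : Adjointable A E} (h : Commute X Y) (x : E) :
    X (Y x) = Y (X x) :=
  congrArg (fun Z : Adjointable A E => Z x) h.eq

theorem norm_apply_le (X : Adjointable A E) (x : E) : ‖X x‖ ≤ ‖X‖ * ‖x‖ :=
  (X : E →L[ℂ] E).le_opNorm x

/-- If `S ≤ R` in `L(E)`, then `⟨S x, x⟩ ≤ ⟨R x, x⟩` for all `x`. -/
theorem inner_apply_mono [CompleteSpace E] {S R : Adjointable A E} (h : S ≤ R) (x : E) :
    inner A x (S x) ≤ inner A x (R x) := by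
  obtain ⟨D, hD⟩ := CStarAlgebra.nonneg_iff_eq_star_mul_self.1 (sub_nonneg.2 h)
  have h1 : R x - S x = (star D) (D x) := congrArg (fun Z : Adjointable A E => Z x) hD
  rw [← sub_nonneg, ← CStarModule.inner_sub_right, h1, inner_apply_right, star_star]
  exact CStarModule.inner_self_nonneg

/-- `⟨X x, X x⟩ ≤ ‖X‖² ⟨x, x⟩` for an adjointable operator `X`. -/
theorem inner_apply_self_le [CompleteSpace E] (X : Adjointable A E) (x : E) :
    inner A (X x) (X x) ≤ (‖X‖ ^ 2) • inner A x x := by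
  have h := inner_apply_mono (CStarAlgebra.star_mul_le_algebraMap_norm_sq (a := X)) x
  have h1 : (algebraMap ℝ (Adjointable A E) (‖X‖ ^ 2)) x = (‖X‖ ^ 2) • x := by
    rw [Algebra.algebraMap_eq_smul_one]
    rfl
  rw [h1, CStarModule.inner_smul_right_real] at h
  rwa [inner_apply_left]

/-- A self-adjoint operator that is bounded below is invertible. -/
theorem isUnit_of_isSelfAdjoint_of_norm_le [CompleteSpace E] {S : Adjointable A E}
    (hS : IsSelfAdjoint S) {c : ℝ} (hc : 0 < c) (h : ∀ x, ‖x‖ ≤ c * ‖S x‖) : IsUnit S := by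
  -- The spectrum of `S` is real, so `z - S` is invertible for this imaginary `z`. The lower bound
  -- on `S` controls its inverse `V`, and `|z|` is small enough that `‖z V‖ ≤ 1/3`; a Neumann series
  -- then inverts `S = -(z - S)(1 - z V)`.
  set z : ℂ := ((4 * c)⁻¹ : ℝ) * Complex.I with hz
  have hzn : ‖z‖ = (4 * c)⁻¹ := by
    rw [hz, norm_mul, Complex.norm_I, mul_one, Complex.norm_real, Real.norm_eq_abs,
      abs_of_pos (by positivity)]
  have hu : IsUnit (algebraMap ℂ (Adjointable A E) z - S) := by
    rw [← spectrum.notMem_iff]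
    intro hmem
    have him := congrArg Complex.im (hS.mem_spectrum_eq_re hmem)
    have hne : (4 * c)⁻¹ ≠ 0 := by positivity
    simp [hz] at him
    exact hc.ne' him
  obtain ⟨u, hu⟩ := hu
  set V : Adjointable A E := ((u⁻¹ : (Adjointable A E)ˣ) : Adjointable A E) with hV
  have hVn : ‖V‖ ≤ 4 / 3 * c := by
    refine (V : E →L[ℂ] E).opNorm_le_bound (by positivity) fun y => ?_
    have huV : z • V y - S (V y) = y := by
      have h1 : (u : Adjointable A E) * V = 1 := u.mul_inv
      rw [hu, Algebra.algebraMap_eq_smul_one] at h1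
      exact congrArg (fun Z : Adjointable A E => Z y) h1
    have h2 : S (V y) = z • V y - y := by
      rw [eq_sub_iff_add_eq, ← sub_eq_iff_eq_add'.1 huV]
    have h3 : ‖S (V y)‖ ≤ (4 * c)⁻¹ * ‖V y‖ + ‖y‖ := by
      rw [h2, ← hzn, ← norm_smul]
      exact norm_sub_le _ _
    have h4 : ‖V y‖ ≤ c * ((4 * c)⁻¹ * ‖V y‖ + ‖y‖) :=
      (h _).trans (mul_le_mul_of_nonneg_left h3 hc.le)
    have h5 : c * ((4 * c)⁻¹ * ‖V y‖ + ‖y‖) = ‖V y‖ / 4 + c * ‖y‖ := by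
      field_simp
    change ‖V y‖ ≤ _
    linarith
  have hlt : ‖z • V‖ < 1 := by
    calc ‖z • V‖ ≤ ‖z‖ * ‖V‖ := norm_smul_le _ _
      _ ≤ (4 * c)⁻¹ * (4 / 3 * c) := by rw [hzn]; gcongr
      _ = 1 / 3 := by field_simp
      _ < 1 := by norm_num
  have hfac : S = -((u : Adjointable A E) * (1 - z • V)) := by
    rw [mul_sub, mul_one, mul_smul_comm, hV, u.mul_inv, hu, Algebra.algebraMap_eq_smul_one]
    abel
  rw [hfac]
  exact (u.isUnit.mul (isUnit_one_sub_of_norm_lt_one hlt)).neg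

theorem isSelfAdjoint_of_inner {S : Adjointable A E}
    (h : ∀ x y, inner A (S x) y = inner A x (S y)) : IsSelfAdjoint S :=
  star_eq_of_isAdjoint h

end Operators

/-! ### Compressions to a complemented submodule -/

section Compression

variable {A E : Type*} [CStarAlgebra A] [PartialOrder A] [StarOrderedRing A]
  [NormedAddCommGroup E] [NormedSpace ℂ E] [Module A E] [IsScalarTower ℂ A E] [CStarModule A E]

/-- `P` is the orthogonal projection of `E` onto `M`. -/
structure IsProjectionOnto (P : Adjointable A E) (M : Submodule A E) : Prop where
  isSelfAdjoint : IsSelfAdjoint P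
  apply_mem : ∀ x, P x ∈ M
  apply_eq : ∀ x ∈ M, P x = x

variable {P : Adjointable A E} {M : Submodule A E}

/-- A bounded operator on `E` with values in `M`, restricted to `M`. -/
def restrictTo (X : E →L[ℂ] E) (M : Submodule A E) (hX : ∀ x ∈ M, X x ∈ M) : M →L[ℂ] M where
  toFun x := ⟨X x, hX x x.2⟩
  map_add' x y := Subtype.ext (map_add X (x : E) (y : E))
  map_smul' c x := Subtype.ext (map_smul X c (x : E))
  cont := (X.continuous.comp continuous_subtype_val).subtype_mk _

theorem inner_projection_apply (hP : IsProjectionOnto P M) (X : Adjointable A E) {x y : E}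
    (hx : x ∈ M) (hy : y ∈ M) : inner A (P (X x)) y = inner A x (P ((star X) y)) := by
  rw [inner_apply_left P, inner_apply_left X, inner_apply_right P x, hP.isSelfAdjoint.star_eq,
    hP.apply_eq x hx, hP.apply_eq y hy]

/-- The compression `P X |_M` of `X` to the range `M` of the projection `P`. -/
def compress (hP : IsProjectionOnto P M) (X : Adjointable A E) : Adjointable A M :=
  ⟨restrictTo ((P : E →L[ℂ] E) * (X : E →L[ℂ] E)) M fun _ _ => hP.apply_mem _,
    restrictTo ((P : E →L[ℂ] E) * ((star X : Adjointable A E) : E →L[ℂ] E)) M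
      fun _ _ => hP.apply_mem _, fun x y => by
    change inner A (P (X (x : E))) (y : E) = inner A (x : E) (P ((star X) (y : E)))
    exact inner_projection_apply hP X x.2 y.2⟩

theorem coe_compress_apply (hP : IsProjectionOnto P M) (X : Adjointable A E) (x : M) :
    ((compress hP X) x : E) = P (X x) :=
  rfl

theorem coe_compress_apply_of_mem (hP : IsProjectionOnto P M) {X : Adjointable A E}
    (hX : ∀ x ∈ M, X x ∈ M) (x : M) : ((compress hP X) x : E) = X x :=
  hP.apply_eq _ (hX x x.2)

/-- `X⋆` need not preserve `M` even when `X` does; this is why compressions are used rather than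
restrictions. -/
theorem star_compress (hP : IsProjectionOnto P M) (X : Adjointable A E) :
    star (compress hP X) = compress hP (star X) :=
  star_eq_of_isAdjoint fun x y => by
    change inner A (P (X (x : E))) (y : E) = inner A (x : E) (P ((star X) (y : E)))
    exact inner_projection_apply hP X x.2 y.2

theorem compress_mul (hP : IsProjectionOnto P M) (X : Adjointable A E) {Y : Adjointable A E}
    (hY : ∀ x ∈ M, Y x ∈ M) : compress hP (X * Y) = compress hP X * compress hP Y := by
  refine Subtype.ext (ContinuousLinearMap.ext fun x => Subtype.ext ?_)
  change P (X (Y (x : E))) = P (X (P (Y (x : E))))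
  rw [hP.apply_eq _ (hY x x.2)]

theorem compress_one (hP : IsProjectionOnto P M) : compress hP 1 = 1 := by
  refine Subtype.ext (ContinuousLinearMap.ext fun x => Subtype.ext ?_)
  exact hP.apply_eq _ x.2

theorem isUnit_compress (hP : IsProjectionOnto P M) (u : (Adjointable A E)ˣ)
    (hu : ∀ x ∈ M, (u : Adjointable A E) x ∈ M)
    (hu' : ∀ x ∈ M, ((u⁻¹ : (Adjointable A E)ˣ) : Adjointable A E) x ∈ M) :
    IsUnit (compress hP (u : Adjointable A E)) :=
  ⟨⟨compress hP u, compress hP ((u⁻¹ : (Adjointable A E)ˣ) : Adjointable A E),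
    by rw [← compress_mul hP _ hu', u.mul_inv, compress_one],
    by rw [← compress_mul hP _ hu, u.inv_mul, compress_one]⟩, rfl⟩

theorem apply_mem_range_of_commute {X T : Adjointable A E} (h : Commute X T) :
    ∀ x ∈ range T, X x ∈ range T := by
  rintro _ ⟨y, rfl⟩
  exact ⟨X y, (apply_apply_of_commute h y).symm⟩

variable [CompleteSpace E]

theorem commute_sqrt {X Y : Adjointable A E} (h : Commute X Y) : Commute (CFC.sqrt X) Y :=
  h.cfcₙ_nnreal _

theorem compress_nonneg [CompleteSpace M] (hP : IsProjectionOnto P M) {X : Adjointable A E}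
    (hX : 0 ≤ X) (hM : ∀ x ∈ M, (CFC.sqrt X) x ∈ M) : 0 ≤ compress hP X := by
  have h : compress hP X = star (compress hP (CFC.sqrt X)) * compress hP (CFC.sqrt X) := by
    rw [star_compress, (CFC.sqrt_nonneg X).isSelfAdjoint.star_eq, ← compress_mul hP _ hM,
      CFC.sqrt_mul_sqrt_self X hX]
  rw [h]
  exact star_mul_self_nonneg _

/-- Uniqueness of the positive square root; invariance of `M` under the fourth root of `X` serves to
show that the candidate is positive. -/
theorem sqrt_compress [CompleteSpace M] (hP : IsProjectionOnto P M) {X : Adjointable A E}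
    (hX : 0 ≤ X) (hM : ∀ x ∈ M, (CFC.sqrt X) x ∈ M)
    (hM' : ∀ x ∈ M, (CFC.sqrt (CFC.sqrt X)) x ∈ M) :
    CFC.sqrt (compress hP X) = compress hP (CFC.sqrt X) :=
  CFC.sqrt_unique (by rw [← compress_mul hP _ hM, CFC.sqrt_mul_sqrt_self X hX])
    (compress_nonneg hP (CFC.sqrt_nonneg X) hM')

end Compression

/-! ### Consequences of a closed range -/

section ClosedRange

variable {A E : Type*} [CStarAlgebra A] [PartialOrder A] [StarOrderedRing A]
  [NormedAddCommGroup E] [NormedSpace ℂ E] [Module A E] [IsScalarTower ℂ A E] [CStarModule A E]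
  [CompleteSpace E]

/-- If `R(T)` is closed, then `T⋆` is bounded below on `R(T)`. -/
theorem exists_norm_le_star_apply {T : Adjointable A E} (hT : IsClosed (range T : Set E)) :
    ∃ c : ℝ, 0 < c ∧ ∀ x ∈ range T, ‖x‖ ≤ c * ‖(star T) x‖ := by
  have : CompleteSpace (range T) := hT.completeSpace_coe
  let G : E →L[ℂ] range T :=
    { toFun := fun x => ⟨T x, x, rfl⟩
      map_add' := fun x y => Subtype.ext (map_add (T : E →L[ℂ] E) x y)
      map_smul' := fun c x => Subtype.ext (map_smul (T : E →L[ℂ] E) c x)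
      cont := (T : E →L[ℂ] E).continuous.subtype_mk _ }
  have hG : Function.Surjective G := by
    rintro ⟨_, x, rfl⟩
    exact ⟨x, rfl⟩
  -- Open mapping theorem: `x = T y` with `‖y‖ ≤ c ‖x‖`; then pair `T y` with `x`.
  obtain ⟨c, hc, h⟩ := G.exists_preimage_norm_le hG
  refine ⟨c, hc, fun x hx => ?_⟩
  obtain ⟨y, hy, hyx⟩ := h ⟨x, hx⟩
  have hy' : T y = x := congrArg Subtype.val hy
  have hn : ‖y‖ ≤ c * ‖x‖ := hyx
  rcases (norm_nonneg x).eq_or_lt with h0 | h0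
  · rw [← h0]
    positivity
  refine le_of_mul_le_mul_right ?_ h0
  calc ‖x‖ * ‖x‖ = ‖inner A (T y) x‖ := by rw [← sq, CStarModule.norm_sq_eq A, hy']
    _ ≤ ‖y‖ * ‖(star T) x‖ := by
        rw [inner_apply_left]
        exact CStarModule.norm_inner_le E
    _ ≤ c * ‖x‖ * ‖(star T) x‖ := by gcongr
    _ = c * ‖(star T) x‖ * ‖x‖ := by ring

/-- The restriction of `T T⋆` to `R(T)`. -/
def rangeSquare (T : Adjointable A E) : Adjointable A (range T) :=
  have hself (x y : E) : inner A (T ((star T) x)) y = inner A x (T ((star T) y)) := by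
    rw [inner_apply_left, ← inner_apply_right]
  ⟨restrictTo ((T : E →L[ℂ] E) * ((star T : Adjointable A E) : E →L[ℂ] E)) (range T)
      fun _ _ => ⟨_, rfl⟩,
    restrictTo ((T : E →L[ℂ] E) * ((star T : Adjointable A E) : E →L[ℂ] E)) (range T)
      fun _ _ => ⟨_, rfl⟩, fun x y => hself x y⟩

theorem coe_rangeSquare_apply (T : Adjointable A E) (x : range T) :
    ((rangeSquare T) x : E) = T ((star T) x) :=
  rfl

/-- The lower bound for `T⋆` on `R(T)`, used twice through `‖T⋆ x‖² = ‖⟨x, T T⋆ x⟩‖`, bounds this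
self-adjoint operator below. -/
theorem isUnit_rangeSquare {T : Adjointable A E} (hT : IsClosed (range T : Set E)) :
    IsUnit (rangeSquare T) := by
  have : CompleteSpace (range T) := hT.completeSpace_coe
  obtain ⟨c, hc, h⟩ := exists_norm_le_star_apply hT
  refine isUnit_of_isSelfAdjoint_of_norm_le (c := c ^ 2) (isSelfAdjoint_of_inner fun x y => ?_)
    (by positivity) fun x => ?_
  · change inner A (T ((star T) (x : E))) (y : E) = inner A (x : E) (T ((star T) (y : E)))
    rw [inner_apply_left, ← inner_apply_right]
  · change ‖(x : E)‖ ≤ c ^ 2 * ‖T ((star T) (x : E))‖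
    rcases (norm_nonneg (x : E)).eq_or_lt with h0 | h0
    · rw [← h0]
      positivity
    refine le_of_mul_le_mul_right ?_ h0
    calc ‖(x : E)‖ * ‖(x : E)‖ ≤ (c * ‖(star T) x‖) * (c * ‖(star T) x‖) :=
          mul_self_le_mul_self h0.le (h x x.2)
      _ = c ^ 2 * ‖inner A (x : E) (T ((star T) (x : E)))‖ := by
          rw [inner_apply_right, ← CStarModule.norm_sq_eq A]
          ring
      _ ≤ c ^ 2 * (‖(x : E)‖ * ‖T ((star T) (x : E))‖) := by
          gcongr
          exact CStarModule.norm_inner_le E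
      _ = c ^ 2 * ‖T ((star T) (x : E))‖ * ‖(x : E)‖ := by ring

/-- A closed range `R(T)` is the range of an orthogonal projection, whose complement is the
kernel of `T⋆`. -/
theorem exists_isProjectionOnto_range {T : Adjointable A E} (hT : IsClosed (range T : Set E)) :
    ∃ P : Adjointable A E, IsProjectionOnto P (range T) ∧
      ∀ x, (star T) (P x) = (star T) x := by
  obtain ⟨u, hu⟩ := isUnit_rangeSquare hT
  set V : Adjointable A (range T) := ((u⁻¹ : (Adjointable A (range T))ˣ) : Adjointable A (range T))
    with hV
  -- The projection is `(T T⋆|R(T))⁻¹ T T⋆`.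
  let Q : E →L[ℂ] E :=
    { toFun := fun x => ((V ⟨T ((star T) x), _, rfl⟩ : range T) : E)
      map_add' := fun x y => by
        rw [← Submodule.coe_add, ← map_add]
        congr 2
        exact Subtype.ext (by simp)
      map_smul' := fun c x => by
        change _ = ((c • V _ : range T) : E)
        rw [← map_smul]
        congr 2
        exact Subtype.ext (by simp)
      cont := continuous_subtype_val.comp ((V : range T →L[ℂ] range T).continuous.comp
        (((T : E →L[ℂ] E).continuous.comp
          ((star T : Adjointable A E) : E →L[ℂ] E).continuous).subtype_mk _)) }
  have hmem (x : E) : Q x ∈ range T := (V ⟨T ((star T) x), _, rfl⟩).2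
  have hTQ (x : E) : T ((star T) (Q x)) = T ((star T) x) := by
    have h1 : rangeSquare T * V = 1 := by rw [← hu]; exact u.mul_inv
    exact congrArg (fun Z : Adjointable A (range T) => (Z ⟨T ((star T) x), _, rfl⟩ : E)) h1
  have hstar (x : E) : (star T) (Q x) = (star T) x := by
    rw [← sub_eq_zero, ← map_sub, ← CStarModule.inner_self (A := A), inner_apply_left, star_star,
      map_sub, map_sub, hTQ, sub_self, CStarModule.inner_zero_right]
  have hfix (x : E) (hx : x ∈ range T) : Q x = x := by
    have h1 : V * rangeSquare T = 1 := by rw [← hu]; exact u.inv_mul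
    exact congrArg (fun Z : Adjointable A (range T) => (Z ⟨x, hx⟩ : E)) h1
  have hinner (x y z : E) (hx : x ∈ range T) (h : (star T) y = (star T) z) :
      inner A x y = inner A x z := by
    obtain ⟨w, rfl⟩ := hx
    rw [inner_apply_left, inner_apply_left, h]
  have hadj : IsAdjoint A E Q Q := fun x y => by
    rw [← hinner (Q x) (Q y) y (hmem x) (hstar y), ← CStarModule.star_inner,
      hinner (Q y) (Q x) x (hmem y) (hstar x), CStarModule.star_inner]
  exact ⟨⟨Q, Q, hadj⟩, ⟨star_eq_of_isAdjoint hadj, hmem, hfix⟩, hstar⟩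

/-- If `R(T)` is closed, then `⟨x, x⟩ ≤ c ⟨T⋆ x, T⋆ x⟩` on `R(T)`. -/
theorem exists_inner_le_star_apply {T : Adjointable A E} (hT : IsClosed (range T : Set E)) :
    ∃ c : ℝ, 0 < c ∧ ∀ x ∈ range T,
      inner A x x ≤ c • inner A ((star T) x) ((star T) x) := by
  have : CompleteSpace (range T) := hT.completeSpace_coe
  obtain ⟨u, hu⟩ := isUnit_rangeSquare hT
  set V : Adjointable A (range T) := ((u⁻¹ : (Adjointable A (range T))ˣ) : Adjointable A (range T))
    with hV
  -- From `x = V (T (T⋆ x))`; the `+ 1` keeps the constant positive when `T = 0`.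
  refine ⟨‖V‖ ^ 2 * ‖T‖ ^ 2 + 1, by positivity, fun x hx => ?_⟩
  have h1 : V ((rangeSquare T) ⟨x, hx⟩) = ⟨x, hx⟩ := by
    have h1 : V * rangeSquare T = 1 := by rw [← hu]; exact u.inv_mul
    exact congrArg (fun Z : Adjointable A (range T) => Z ⟨x, hx⟩) h1
  have h2 := inner_apply_self_le V ((rangeSquare T) ⟨x, hx⟩)
  rw [h1] at h2
  have h3 : inner A x x ≤ ‖V‖ ^ 2 • inner A (T ((star T) x)) (T ((star T) x)) := h2
  have h4 := inner_apply_self_le T ((star T) x)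
  have h5 : (0 : A) ≤ inner A ((star T) x) ((star T) x) := CStarModule.inner_self_nonneg
  calc inner A x x ≤ ‖V‖ ^ 2 • (‖T‖ ^ 2 • inner A ((star T) x) ((star T) x)) :=
        h3.trans (smul_le_smul_of_nonneg_left h4 (by positivity))
    _ = (‖V‖ ^ 2 * ‖T‖ ^ 2) • inner A ((star T) x) ((star T) x) := by rw [mul_smul]
    _ ≤ _ := smul_le_smul_of_nonneg_right (by linarith) h5

end ClosedRange

end HilbertCStarModule

end

/-! ### The controlled frame on the range -/

theorem mainTheorem7 {A H J : Type*} [CStarAlgebra A] [PartialOrder A] [StarOrderedRing A]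
    [NormedAddCommGroup H] [NormedSpace ℂ H] [Module A H] [IsScalarTower ℂ A H]
    [CStarModule A H] [CompleteSpace H] [Countable J]
    (C K T : HilbertCStarModule.Adjointable A H) (ψ : J → H)
    (hψ : HilbertCStarModule.IsControlledKFrame C K ψ)
    (hT : IsClosed (HilbertCStarModule.range T : Set H))
    (hTK : HilbertCStarModule.IsOrthogonallyComplemented A
      (closure (HilbertCStarModule.range (T * K) : Set H)))
    (hCK : Commute C K) (hCT : Commute C T) (hKT : Commute K T) :
    haveI : CompleteSpace (HilbertCStarModule.range T) := hT.completeSpace_coe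
    ∃ C' K' : HilbertCStarModule.Adjointable A (HilbertCStarModule.range T),
      (∀ x : HilbertCStarModule.range T, (C' x : H) = C x) ∧
      (∀ x : HilbertCStarModule.range T, (K' x : H) = K x) ∧
      HilbertCStarModule.IsControlledKFrame C' K'
        (fun j => (⟨T (ψ j), ψ j, rfl⟩ : HilbertCStarModule.range T)) := by
  have : CompleteSpace (HilbertCStarModule.range T) := hT.completeSpace_coe
  obtain ⟨P, hP, hPT⟩ := HilbertCStarModule.exists_isProjectionOnto_range hT
  obtain ⟨c, hc, hcT⟩ := HilbertCStarModule.exists_inner_le_star_apply hT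
  have hC := hψ.nonneg
  have hsT : Commute (CFC.sqrt C) T := HilbertCStarModule.commute_sqrt hCT
  have hCM := HilbertCStarModule.apply_mem_range_of_commute hCT
  have hKM := HilbertCStarModule.apply_mem_range_of_commute hKT
  have hsM := HilbertCStarModule.apply_mem_range_of_commute hsT
  have hssM := HilbertCStarModule.apply_mem_range_of_commute
    (HilbertCStarModule.commute_sqrt hsT)
  have hsT' : Commute (CFC.sqrt C) (star T) := by
    have h := hsT.star_star
    rwa [(CFC.sqrt_nonneg C).isSelfAdjoint.star_eq] at h
  have hKT' : Commute (star K) (star T) := hKT.star_star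
  obtain ⟨a, b, ha, hab, hf⟩ := hψ.bounds
  have hterm : ∀ (f : HilbertCStarModule.range T) (j : J),
      inner A (ψ j) ((star T) (f : H)) * inner A ((star T) (f : H)) (C (ψ j)) =
        inner A (T (ψ j)) (f : H) * inner A (f : H) (C (T (ψ j))) := fun f j => by
    rw [HilbertCStarModule.apply_apply_of_commute hCT,
      HilbertCStarModule.inner_apply_left T, HilbertCStarModule.inner_apply_right T]
  refine ⟨HilbertCStarModule.compress hP C, HilbertCStarModule.compress hP K,
    HilbertCStarModule.coe_compress_apply_of_mem hP hCM,
    HilbertCStarModule.coe_compress_apply_of_mem hP hKM,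
    HilbertCStarModule.compress_nonneg hP hC hsM, ?_, ?_⟩
  · obtain ⟨u, rfl⟩ := hψ.isUnit
    exact HilbertCStarModule.isUnit_compress hP u hCM
      (HilbertCStarModule.apply_mem_range_of_commute hCT.units_inv_left)
  -- The summand `c⁻¹ * a` in the upper constant only makes the two constants ordered.
  refine ⟨c⁻¹ * a, c⁻¹ * a + b * ‖star T‖ ^ 2, by positivity,
    le_add_of_nonneg_right (by have := ha.le.trans hab; positivity), fun f => ?_⟩
  have hterms : (fun j => inner A (⟨T (ψ j), ψ j, rfl⟩ : HilbertCStarModule.range T) f *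
      inner A f ((HilbertCStarModule.compress hP C)
        (⟨T (ψ j), ψ j, rfl⟩ : HilbertCStarModule.range T))) =
      fun j => inner A (ψ j) ((star T) (f : H)) * inner A ((star T) (f : H)) (C (ψ j)) := by
    funext j
    rw [hterm f j, ← HilbertCStarModule.coe_compress_apply_of_mem hP hCM
      (⟨T (ψ j), ψ j, rfl⟩ : HilbertCStarModule.range T)]
    rfl
  obtain ⟨hsum, hlow, hup⟩ := hf ((star T) (f : H))
  rw [hterms]
  refine ⟨hsum, ?_, ?_⟩
  · rw [HilbertCStarModule.sqrt_compress hP hC hsM hssM, HilbertCStarModule.star_compress]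
    set g : H := (CFC.sqrt C) (P ((star K) (f : H))) with hg
    have hgM : g ∈ HilbertCStarModule.range T := hsM _ (hP.apply_mem _)
    have hgT : (star T) g = (CFC.sqrt C) ((star K) ((star T) (f : H))) := by
      rw [hg, ← HilbertCStarModule.apply_apply_of_commute hsT', hPT,
        HilbertCStarModule.apply_apply_of_commute hKT']
    have hgg : ((HilbertCStarModule.compress hP (CFC.sqrt C))
        ((HilbertCStarModule.compress hP (star K)) f) : H) = g := hP.apply_eq g hgM
    change (c⁻¹ * a) • inner A
      ((HilbertCStarModule.compress hP (CFC.sqrt C))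
        ((HilbertCStarModule.compress hP (star K)) f) : H)
      ((HilbertCStarModule.compress hP (CFC.sqrt C))
        ((HilbertCStarModule.compress hP (star K)) f) : H) ≤ _
    rw [hgg]
    refine le_trans ?_ hlow
    rw [← hgT]
    calc (c⁻¹ * a) • inner A g g ≤ (c⁻¹ * a) • (c • inner A ((star T) g) ((star T) g)) :=
          smul_le_smul_of_nonneg_left (hcT g hgM) (by positivity)
      _ = a • inner A ((star T) g) ((star T) g) := by
          rw [smul_smul]
          congr 1
          field_simp
  · have h0 : (0 : A) ≤ inner A (f : H) (f : H) := CStarModule.inner_self_nonneg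
    change _ ≤ _ • inner A (f : H) (f : H)
    calc _ ≤ b • inner A ((star T) (f : H)) ((star T) (f : H)) := hup
      _ ≤ b • (‖star T‖ ^ 2 • inner A (f : H) (f : H)) :=
          smul_le_smul_of_nonneg_left (HilbertCStarModule.inner_apply_self_le _ _)
            (ha.le.trans hab)
      _ = (b * ‖star T‖ ^ 2) • inner A (f : H) (f : H) := by rw [mul_smul]
      _ ≤ _ := smul_le_smul_of_nonneg_right (le_add_of_nonneg_left (by positivity)) h0
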